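/- Notation. For $c>0$ and $|\varphi|\le\pi/2$ let $$A(x;c,\varphi)=\frac{(c^2-x^2)\sin\varphi}{c\cos\varphi+\sqrt{c^2-x^2\sin^2\varphi}},\qquad |x|\le c,$$ be the circular arc over the chord $[-c,c]$ of the $x$-axis with start tangent of inclination $\varphi$. Let $|\alpha|,|\beta|\le\pi/2$, $\alpha+\beta\ge 0$ and $\omega=\frac{\alpha+\beta}{2}$. If $\alpha+\beta>0$ and $p\in(0,\infty)$, let $B_0(x;c,\alpha,\beta,p)$ be the biarc from $(-c,0)$ to $(c,0)$ with end tangents of inclination $\alpha$ and $\beta$, whose first arc has the signed curvature $-\frac1c\bigl(\sin\alpha+\frac1p\sin\omega\bigr)$ and whose second arc has the signed curvature $\frac1c\bigl(\sin\beta+p\sin\omega\bigr)$, the two arcs being joined with a common tangent at the abscissa $c\,\frac{p^2-1}{p^2+2p\cos\frac{\alpha-\beta}{2}+1}$. The degenerate biarcs are $B_0(x;c,\alpha,\beta,0)=A(x;c,-\beta)$, $B_0(x;c,\alpha,\beta,\infty)=A(x;c,\alpha)$ and, if $\alpha+\beta=0$, $B_0(x;c,\alpha,\beta,p)=A(x;c,\alpha)$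 for all $p$. The biarc with end tangents $\alpha,\beta$ and start curvature $a\in[-\infty,\infty)$ is $B_1(x;c,\alpha,\beta,a)=B_0(x;c,\alpha,\beta,p)$ with $p=-\frac{\sin\omega}{ac+\sin\alpha}$ ($p=0$ if $a=-\infty$, $p=\infty$ if $ac+\sin\alpha=0$). The biarc with end tangents $\alpha,\beta$ and end curvature $b\in(-\infty,\infty]$ is $B_2(x;c,\alpha,\beta,b)=B_0(x;c,\alpha,\beta,p)$ with $p=\frac{bc-\sin\beta}{\sin\omega}$ ($p=\infty$ if $b=+\infty$); if $\alpha+\beta=0$, then $B_1=B_2=A(x;c,\alpha)$. Proposition 4. Let $y=f(x)$, $|x|\le c$, $f(\pm c)=0$, be a spiral arc with increasing (i.e. nondecreasing) curvature: a curve with a continuously turning tangent, projecting one-to-one onto its chord $[-c,c]$, whose signed curvature $\kappa(x)=y''/(1+y'^2)^{3/2}$ is defined on $(-c,c)$ with at most countably many exceptions and is nondecreasing. Let $\alpha$ and $\beta$ be the inclinations, in $[-\pi/2,\pi/2]$, of its tangents at $x=-c$ and $x=c$ (vertical tangents are allowed). Suppose that $$\alpha'\le\alpha\le\alpha''\le\tfrac{\pi}{2},\qquad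 \beta'\le\beta\le\beta''\le\tfrac{\pi}{2},\qquad -\infty\le a\le\kappa(x)\le b\le+\infty .$$ Then, for all $x\in[-c,c]$, $$\text{if }\alpha'+\beta''\ge0:\quad B_1(x;c,\alpha',\beta'',a)\le f(x);\qquad\qquad \text{if }\alpha''+\beta'\ge0:\quad f(x)\le B_2(x;c,\alpha'',\beta',b).$$ -/

import Mathlib

open Set Filter Topology

/-- The curve `y = f x`, `x ∈ s`, has at the point `(x, f x)` a tangent of inclination `θ`:
the inclinations of the secants through that point tend to `θ`. Thus `θ ∈ [-π/2, π/2]`, where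
`θ = ±π/2` is a vertical tangent; otherwise `f` has the derivative `tan θ` at `x` within `s`. -/
def HasTangentAngle (f : ℝ → ℝ) (s : Set ℝ) (x θ : ℝ) : Prop :=
  Tendsto (fun y => Real.arctan ((f y - f x) / (y - x))) (𝓝[s \ {x}] x) (𝓝 θ)

/-- The curve `y = f x` has at the point `(x, f x)` the signed curvature
`k = y'' / (1 + y' ^ 2) ^ (3 / 2)`. -/
def HasCurvatureAt (f : ℝ → ℝ) (x k : ℝ) : Prop :=
  (∀ᶠ y in 𝓝 x, DifferentiableAt ℝ f y) ∧ DifferentiableAt ℝ (deriv f) x ∧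
    k = deriv (deriv f) x / (1 + deriv f x ^ 2) ^ (3 / 2 : ℝ)

/-- `y = f x` is a spiral arc of increasing (that is, nondecreasing) curvature over the chord
`[-c, c]`, with end tangents of inclination `α` and `β`: a continuous curve with a continuously
turning tangent, whose curvature is defined with at most countably many exceptions (such as joints
of circular arcs) and does not decrease. -/
structure IsSpiralArc (c α β : ℝ) (f : ℝ → ℝ) : Prop where
  chord_pos : 0 < c
  continuousOn : ContinuousOn f (Icc (-c) c)
  left_eq : f (-c) = 0
  right_eq : f c = 0
  tangent : ∃ τ : ℝ → ℝ, ContinuousOn τ (Icc (-c) c) ∧ τ (-c) = α ∧ τ c = β ∧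
    ∀ x ∈ Icc (-c) c, HasTangentAngle f (Icc (-c) c) x (τ x)
  curvature_countable : {x ∈ Ioo (-c) c | ¬ ∃ k, HasCurvatureAt f x k}.Countable
  curvature_mono : ∀ x ∈ Ioo (-c) c, ∀ y ∈ Ioo (-c) c, x < y →
    ∀ k l, HasCurvatureAt f x k → HasCurvatureAt f y l → k ≤ l

/-- `A(x; c, φ)`: the circular arc over the chord `[-c, c]` with start tangent of inclination `φ`,
`|φ| ≤ π/2`. -/
noncomputable def chordArc (c φ x : ℝ) : ℝ :=
  (c ^ 2 - x ^ 2) * Real.sin φ /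
    (c * Real.cos φ + √(c ^ 2 - x ^ 2 * Real.sin φ ^ 2))

/-- The arc of signed curvature `k` (a straight segment if `k = 0`) through the point `(x₀, 0)`,
where its tangent has inclination `φ`, `|φ| ≤ π/2`. The sine of the inclination of the tangent at
abscissa `x` is `sin φ + k * (x - x₀)`; for `k ≠ 0` the ordinate equals
`(cos φ - √(1 - (sin φ + k * (x - x₀)) ^ 2)) / k`. -/
noncomputable def tangentArc (x₀ φ k x : ℝ) : ℝ :=
  (x - x₀) * (2 * Real.sin φ + k * (x - x₀)) /
    (Real.cos φ + √(1 - (Real.sin φ + k * (x - x₀)) ^ 2))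

/-- The start curvature of the biarc with parameter `p`. -/
noncomputable def biarcStartCurvature (c α β p : ℝ) : ℝ :=
  -(Real.sin α + Real.sin ((α + β) / 2) / p) / c

/-- The end curvature of the biarc with parameter `p`. -/
noncomputable def biarcEndCurvature (c α β p : ℝ) : ℝ :=
  (Real.sin β + p * Real.sin ((α + β) / 2)) / c

/-- The abscissa of the joint of the biarc with parameter `p`. -/
noncomputable def biarcJoint (c α β p : ℝ) : ℝ :=
  c * (p ^ 2 - 1) / (p ^ 2 + 2 * p * Real.cos ((α - β) / 2) + 1)

/-- `B₀(x; c, α, β, p)`, `p ∈ [0, ∞]`: the family of biarcs over the chord `[-c, c]` with end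
tangents of inclination `α`, `β`, including the degenerate ones. -/
noncomputable def biarc₀ (c α β : ℝ) (p : ENNReal) (x : ℝ) : ℝ :=
  open Classical in
  if α + β = 0 then chordArc c α x
  else if p = 0 then chordArc c (-β) x
  else if p = ⊤ then chordArc c α x
  else if x ≤ biarcJoint c α β p.toReal then
    tangentArc (-c) α (biarcStartCurvature c α β p.toReal) x
  else tangentArc c β (biarcEndCurvature c α β p.toReal) x

/-- `B₁(x; c, α, β, a)`: the biarc with end tangents `α`, `β` and start curvature `a`. Here
`p = 0` for an infinite `a`, and `p = ∞` if `a * c + sin α = 0`. -/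
noncomputable def biarc₁ (c α β : ℝ) (a : EReal) (x : ℝ) : ℝ :=
  open Classical in
  biarc₀ c α β
    (if a = ⊥ ∨ a = ⊤ then 0
      else if a.toReal * c + Real.sin α = 0 then ⊤
      else ENNReal.ofReal (-Real.sin ((α + β) / 2) / (a.toReal * c + Real.sin α))) x

/-- `B₂(x; c, α, β, b)`: the biarc with end tangents `α`, `β` and end curvature `b`. Here
`p = ∞` for an infinite `b`, and `p = 0` if `b * c - sin β = 0`. -/
noncomputable def biarc₂ (c α β : ℝ) (b : EReal) (x : ℝ) : ℝ :=
  open Classical in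
  biarc₀ c α β
    (if b = ⊥ ∨ b = ⊤ then ⊤
      else ENNReal.ofReal ((b.toReal * c - Real.sin β) / Real.sin ((α + β) / 2))) x

/-- The two arcs of a biarc are joined smoothly: the joint lies strictly between the ends, and
there the arcs have the same tangent direction and the same ordinate. -/
theorem biarc_join (c α β p : ℝ) (hc : 0 < c) (hα : α ≤ Real.pi / 2) (hβ : β ≤ Real.pi / 2)
    (h : 0 < α + β) (hp : 0 < p) :
    biarcJoint c α β p ∈ Ioo (-c) c ∧
    Real.sin α + biarcStartCurvature c α β p * (biarcJoint c α β p - -c) =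
      Real.sin β + biarcEndCurvature c α β p * (biarcJoint c α β p - c) ∧
    tangentArc (-c) α (biarcStartCurvature c α β p) (biarcJoint c α β p) =
      tangentArc c β (biarcEndCurvature c α β p) (biarcJoint c α β p) := by
  obtain ⟨w, g, rfl, rfl⟩ : ∃ w g : ℝ, α = w + g ∧ β = w - g :=
    ⟨(α + β) / 2, (α - β) / 2, by ring, by ring⟩
  have e1 : (w + g + (w - g)) / 2 = w := by ring
  have e2 : (w + g - (w - g)) / 2 = g := by ring
  have hcg : 0 ≤ Real.cos g := Real.cos_nonneg_of_neg_pi_div_two_le_of_le (by linarith) (by linarith)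
  have hcg' : 0 < Real.cos g := Real.cos_pos_of_mem_Ioo ⟨by linarith, by linarith⟩
  have hcw : 0 ≤ Real.cos w := Real.cos_nonneg_of_neg_pi_div_two_le_of_le (by linarith) (by linarith)
  have hca : 0 ≤ Real.cos (w + g) :=
    Real.cos_nonneg_of_neg_pi_div_two_le_of_le (by linarith) (by linarith)
  have hcb : 0 ≤ Real.cos (w - g) :=
    Real.cos_nonneg_of_neg_pi_div_two_le_of_le (by linarith) (by linarith)
  have hw := Real.sin_sq_add_cos_sq w
  have hg := Real.sin_sq_add_cos_sq g
  simp only [biarcJoint, biarcStartCurvature, biarcEndCurvature, tangentArc, e1, e2]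
  rw [Real.cos_add] at hca
  rw [Real.cos_sub] at hcb
  rw [Real.sin_add, Real.sin_sub, Real.cos_add, Real.cos_sub]
  generalize Real.sin w = sw at *
  generalize Real.cos w = cw at *
  generalize Real.sin g = sg at *
  generalize Real.cos g = cg at *
  obtain ⟨D, hD⟩ : ∃ D, D = p ^ 2 + 2 * p * cg + 1 := ⟨_, rfl⟩
  have hDpos : 0 < D := by rw [hD]; positivity
  have hx : c * (p ^ 2 - 1) / D - -c = 2 * c * p * (p + cg) / D := by
    field_simp; rw [hD]; ring
  have hx' : c * (p ^ 2 - 1) / D - c = -(2 * c * (1 + p * cg)) / D := by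
    field_simp; rw [hD]; ring
  rw [← hD, hx, hx']
  -- sine and cosine of the tangent angle at the joint
  obtain ⟨S, hS⟩ : ∃ S, S = -(p ^ 2 * (sw * cg + cw * sg) + (sw * cg - cw * sg) + 2 * p * sw) / D :=
    ⟨_, rfl⟩
  obtain ⟨C, hC⟩ : ∃ C, C = (p ^ 2 * (cw * cg - sw * sg) + (cw * cg + sw * sg) + 2 * p * cw) / D :=
    ⟨_, rfl⟩
  have hSD : S * D = -(p ^ 2 * (sw * cg + cw * sg) + (sw * cg - cw * sg) + 2 * p * sw) := by
    rw [hS]; field_simp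
  have hCD : C * D = p ^ 2 * (cw * cg - sw * sg) + (cw * cg + sw * sg) + 2 * p * cw := by
    rw [hC]; field_simp
  have hC0 : 0 ≤ C := by rw [hC]; positivity
  have hSC : 1 - S ^ 2 = C ^ 2 := by
    have : (1 - S ^ 2 - C ^ 2) * D ^ 2 = 0 := by
      have : (1 - S ^ 2 - C ^ 2) * D ^ 2 = D ^ 2 - (S * D) ^ 2 - (C * D) ^ 2 := by ring
      rw [this, hSD, hCD, hD]
      linear_combination -(p ^ 4 * (sg ^ 2 + cg ^ 2) + (sg ^ 2 + cg ^ 2) + 4 * p ^ 2 +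
        2 * p ^ 2 * (cg ^ 2 - sg ^ 2) + 4 * p ^ 3 * cg + 4 * p * cg) * hw +
        (2 * p ^ 2 - p ^ 4 - 1) * hg
    have := (mul_eq_zero.1 this).resolve_right (by positivity)
    linarith
  have hsq : √(1 - S ^ 2) = C := by rw [hSC, Real.sqrt_sq hC0]
  have hS1 : sw * cg + cw * sg + -(sw * cg + cw * sg + sw / p) / c * (2 * c * p * (p + cg) / D)
      = S := by
    rw [hS]; field_simp; rw [hD]; ring
  have hS2 : sw * cg - cw * sg + (sw * cg - cw * sg + p * sw) / c * (-(2 * c * (1 + p * cg)) / D)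
      = S := by
    rw [hS]; field_simp; rw [hD]; ring
  have hT1 : 2 * (sw * cg + cw * sg) +
      -(sw * cg + cw * sg + sw / p) / c * (2 * c * p * (p + cg) / D) = sw * cg + cw * sg + S := by
    linarith
  have hT2 : 2 * (sw * cg - cw * sg) +
      (sw * cg - cw * sg + p * sw) / c * (-(2 * c * (1 + p * cg)) / D) = sw * cg - cw * sg + S := by
    linarith
  rw [hT1, hT2, hS1, hS2, hsq]
  refine ⟨⟨?_, ?_⟩, rfl, ?_⟩
  · have : 0 < 2 * c * p * (p + cg) / D := by positivity
    linarith
  · have : 0 < 2 * c * (1 + p * cg) / D := by positivity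
    rw [neg_div] at hx'
    linarith
  · have k1 : (sw * cg + cw * sg + S) * (p + cg) = sg * (cw * cg - sw * sg + C) := by
      apply mul_right_cancel₀ hDpos.ne'
      have : (sw * cg + cw * sg + S) * (p + cg) * D - sg * (cw * cg - sw * sg + C) * D =
        ((sw * cg + cw * sg) * D + S * D) * (p + cg) - sg * ((cw * cg - sw * sg) * D + C * D) := by
        ring
      rw [← sub_eq_zero, this, hSD, hCD, hD]
      linear_combination 2 * p * sw * (p + cg) * hg
    have k2 : (sw * cg - cw * sg + S) * (1 + p * cg) = -(p * sg) * (cw * cg + sw * sg + C) := by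
      apply mul_right_cancel₀ hDpos.ne'
      have : (sw * cg - cw * sg + S) * (1 + p * cg) * D - -(p * sg) * (cw * cg + sw * sg + C) * D =
        ((sw * cg - cw * sg) * D + S * D) * (1 + p * cg) +
          p * sg * ((cw * cg + sw * sg) * D + C * D) := by
        ring
      rw [← sub_eq_zero, this, hSD, hCD, hD]
      linear_combination 2 * p * sw * (1 + p * cg) * hg
    have l1 : 2 * c * p * (p + cg) / D * (sw * cg + cw * sg + S) =
        2 * c * p * sg / D * (cw * cg - sw * sg + C) := by
      linear_combination 2 * c * p / D * k1
    have l2 : -(2 * c * (1 + p * cg)) / D * (sw * cg - cw * sg + S) =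
        2 * c * p * sg / D * (cw * cg + sw * sg + C) := by
      linear_combination -(2 * c / D) * k2
    rw [l1, l2]
    -- the denominators vanish only if both end tangents are vertical
    by_cases h0 : C = 0
    · have hCD0 : p ^ 2 * (cw * cg - sw * sg) + (cw * cg + sw * sg) + 2 * p * cw = 0 := by
        rw [← hCD, h0, zero_mul]
      have t1 : 0 ≤ p ^ 2 * (cw * cg - sw * sg) := by positivity
      have t2 : 0 ≤ 2 * p * cw := by positivity
      have t3 : p ^ 2 * (cw * cg - sw * sg) = 0 := by linarith
      have t4 : cw * cg - sw * sg = 0 := (mul_eq_zero.1 t3).resolve_left (by positivity)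
      have t5 : cw * cg + sw * sg = 0 := by linarith
      rw [t4, t5]
    · have hCpos : 0 < C := lt_of_le_of_ne hC0 (Ne.symm h0)
      rw [mul_div_cancel_right₀ _ (by positivity), mul_div_cancel_right₀ _ (by positivity)]

/-! Describe a curve by the sine S of its tangent inclination, as a function of the abscissa. The
derivative of S is the curvature (`HasCurvatureAt.hasDerivAt_sin`), so nondecreasing curvature makes
S convex, while S is affine on a circular arc and piecewise affine on a biarc. The slope of the
curve is S/√(1 - S²), an increasing function of S, so comparing sines compares slopes.

For the upper bound in the nondegenerate case, let T be the sine for the biarc B. It starts at sin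
α'' ≥ S(-c), is affine up to the joint, and then follows the line of slope b through (c, sin β'),
which lies below S because κ ≤ b. By convexity S ≤ T on an initial interval, and T ≤ S after it.
Hence f - B falls from 0 and then rises back to 0, so f ≤ B (`le_of_convexOn_of_affine`,
`HasTangentSine.le_biarc₂`).

The lower bound is the upper bound for -f(-x): reflection in the origin exchanges the end tangents,
inverts p and turns a start curvature a into the end curvature -a. Countably many exceptional
abscissae are harmless by `le_of_deriv_nonneg_off_countable`. -/

/-! ### Monotonicity and convexity from derivatives off a countable set -/

/-- A continuous function on an interval whose derivative is nonnegative off a countable set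
takes at the right end a value at least as large as at the left end. -/
theorem le_of_deriv_nonneg_off_countable {F : ℝ → ℝ} {l r : ℝ} {Z : Set ℝ} (hlr : l ≤ r)
    (hF : ContinuousOn F (Icc l r)) (hZ : Z.Countable)
    (hd : ∀ x ∈ Ioo l r, x ∉ Z → ∃ d, 0 ≤ d ∧ HasDerivAt F d x) : F l ≤ F r := by
  by_contra! hlt
  have hlr' : l < r := lt_of_le_of_ne hlr (by rintro rfl; exact lt_irrefl _ hlt)
  -- The tilt by ε makes the derivative strictly positive while keeping the value at `r` below that
  -- at `l`.
  obtain ⟨ε, hε, hεlt⟩ : ∃ ε : ℝ, 0 < ε ∧ ε * (r - l) < F l - F r := by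
    have h1 : 0 < r - l := by linarith
    refine ⟨(F l - F r) / (2 * (r - l)), div_pos (by linarith) (by linarith), ?_⟩
    have : (F l - F r) / (2 * (r - l)) * (r - l) = (F l - F r) / 2 := by field_simp
    linarith
  set G : ℝ → ℝ := fun x => F x + ε * (x - l) with hG
  have hGc : ContinuousOn G (Icc l r) := hF.add (by fun_prop)
  have hGlr : G r < G l := by simp only [hG]; linarith
  -- The image of `Z` is countable, so some intermediate value v is attained only off `Z`. At the
  -- last point with `v ≤ G`, the function should drop below v, but its derivative there is
  -- positive.
  obtain ⟨v, hv, hvZ⟩ : ∃ v ∈ Ioo (G r) (G l), v ∉ G '' Z := by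
    by_contra! h
    exact (Cardinal.Real.Ioo_countable_iff.not.2 (not_le.2 hGlr)) ((hZ.image G).mono h)
  have hK : IsCompact (Icc l r ∩ G ⁻¹' Ici v) :=
    isCompact_Icc.of_isClosed_subset (hGc.preimage_isClosed_of_isClosed isClosed_Icc isClosed_Ici)
      inter_subset_left
  obtain ⟨z, ⟨hz, hzv⟩, hmax⟩ := hK.exists_isGreatest ⟨l, left_mem_Icc.2 hlr, hv.2.le⟩
  have hzv' : v ≤ G z := hzv
  have hzr : z < r := lt_of_le_of_ne hz.2 (by rintro rfl; exact absurd hv.1 (not_lt.2 hzv'))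
  have key : ¬ ∀ᶠ y in 𝓝[>] z, v ≤ G y := by
    intro h
    obtain ⟨y, hy, hy1, hy2⟩ := (h.and (Ioo_mem_nhdsGT hzr)).exists
    exact absurd (hmax ⟨⟨hz.1.trans hy1.le, hy2.le⟩, hy⟩) (not_le.2 hy1)
  rcases hzv'.lt_or_eq with h | h
  · apply key
    have h1 : ∀ᶠ y in 𝓝[Icc l r] z, v < G y := (hGc z hz).eventually (lt_mem_nhds h)
    have h2 : 𝓝[>] z ≤ 𝓝[Icc l r] z := by
      rw [← nhdsWithin_Ioo_eq_nhdsGT hzr]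
      exact nhdsWithin_mono _ fun y hy => ⟨hz.1.trans hy.1.le, hy.2.le⟩
    filter_upwards [h2 h1] with y hy using hy.le
  · have hzl : l < z := lt_of_le_of_ne hz.1 (by rintro rfl; exact absurd hv.2 (not_lt.2 h.ge))
    obtain ⟨d, hd0, hd1⟩ := hd z ⟨hzl, hzr⟩ fun hzZ => hvZ ⟨z, hzZ, h.symm⟩
    have hGd : HasDerivAt G (d + ε * 1) z :=
      hd1.add (((hasDerivAt_id z).sub_const l).const_mul ε)
    have h1 := (hasDerivAt_iff_tendsto_slope.1 hGd).eventually (lt_mem_nhds (a := 0) (by linarith))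
    apply key
    filter_upwards [nhdsGT_le_nhdsNE z h1, self_mem_nhdsWithin] with y hy hyz
    rw [slope_def_field] at hy
    have := (div_pos_iff_of_pos_right (sub_pos.2 (show z < y from hyz))).1 hy
    linarith

/-- A continuous function with monotone derivative off a countable set is convex. -/
theorem convexOn_of_deriv_mono_off_countable {s : ℝ → ℝ} {l r : ℝ} {Z : Set ℝ}
    (hs : ContinuousOn s (Icc l r)) (hZ : Z.Countable)
    (hd : ∀ x ∈ Ioo l r, x ∉ Z → DifferentiableAt ℝ s x)
    (hm : ∀ x ∈ Ioo l r, ∀ y ∈ Ioo l r, x < y → x ∉ Z → y ∉ Z → deriv s x ≤ deriv s y) :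
    ConvexOn ℝ (Icc l r) s := by
  have good : ∀ u v : ℝ, u < v → ∃ t ∈ Ioo u v, t ∉ Z := by
    intro u v huv
    by_contra! h
    exact (Cardinal.Real.Ioo_countable_iff.not.2 (not_le.2 huv)) (hZ.mono h)
  refine convexOn_of_slope_mono_adjacent (convex_Icc l r) fun {x y z} hx hz hxy hyz => ?_
  obtain ⟨m, hm1, hm2⟩ : ∃ m, (∀ t ∈ Ioo x y, t ∉ Z → deriv s t ≤ m) ∧
      ∀ t ∈ Ioo y z, t ∉ Z → m ≤ deriv s t := by
    have hle : ∀ t ∈ Ioo x y, t ∉ Z → ∀ u ∈ Ioo y z, u ∉ Z → deriv s t ≤ deriv s u :=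
      fun t ht htZ u hu huZ => hm t ⟨hx.1.trans_lt ht.1, by linarith [ht.2, hu.1, hu.2, hz.2]⟩ u
        ⟨by linarith [ht.2, hu.1, ht.1, hx.1], hu.2.trans_le hz.2⟩ (ht.2.trans hu.1) htZ huZ
    obtain ⟨t₀, ht₀, ht₀Z⟩ := good x y hxy
    obtain ⟨u₀, hu₀, hu₀Z⟩ := good y z hyz
    -- The supremum of the derivatives left of `y` separates them from those on the right; it is
    -- finite because good points exist on both sides.
    refine ⟨sSup (deriv s '' (Ioo x y \ Z)), fun t ht htZ => ?_, fun u hu huZ => ?_⟩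
    · refine le_csSup ⟨deriv s u₀, ?_⟩ ⟨t, ⟨ht, htZ⟩, rfl⟩
      rintro _ ⟨t, ht, rfl⟩
      exact hle t ht.1 ht.2 u₀ hu₀ hu₀Z
    · refine csSup_le ⟨_, t₀, ⟨ht₀, ht₀Z⟩, rfl⟩ ?_
      rintro _ ⟨t, ht, rfl⟩
      exact hle t ht.1 ht.2 u hu huZ
  trans m
  · rw [div_le_iff₀ (by linarith)]
    have := le_of_deriv_nonneg_off_countable (F := fun t => m * t - s t) hxy.le
      (ContinuousOn.sub (by fun_prop) (hs.mono (Icc_subset_Icc hx.1 (hyz.le.trans hz.2)))) hZ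
      fun t ht htZ => ⟨m * 1 - deriv s t, by linarith [hm1 t ht htZ],
        ((hasDerivAt_id t).const_mul m).sub (hd t ⟨hx.1.trans_lt ht.1,
          by linarith [ht.2, hz.2]⟩ htZ).hasDerivAt⟩
    linarith
  · rw [le_div_iff₀ (by linarith)]
    have := le_of_deriv_nonneg_off_countable (F := fun t => s t - m * t) hyz.le
      (ContinuousOn.sub (hs.mono (Icc_subset_Icc (hx.1.trans hxy.le) hz.2)) (by fun_prop)) hZ
      fun t ht htZ => ⟨deriv s t - m * 1, by linarith [hm2 t ht htZ],
        (hd t ⟨by linarith [ht.1, hx.1], ht.2.trans_le hz.2⟩ htZ).hasDerivAt.sub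
        ((hasDerivAt_id t).const_mul m)⟩
    linarith

/-! ### Curves described by their tangent sine, and their comparison -/

/-- The curve `y = F x`, `l ≤ x ≤ r`, is continuous and, off a countable set, has tangents
whose inclinations have the sines `S x`. -/
def HasTangentSine (F S : ℝ → ℝ) (l r : ℝ) : Prop :=
  ContinuousOn F (Icc l r) ∧ ∃ Z : Set ℝ, Z.Countable ∧
    ∀ x ∈ Ioo l r, x ∉ Z → |S x| < 1 ∧ HasDerivAt F (S x / √(1 - S x ^ 2)) x

theorem HasTangentSine.mono {F S : ℝ → ℝ} {l r l' r' : ℝ} (h : HasTangentSine F S l r)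
    (hl : l ≤ l') (hr : r' ≤ r) : HasTangentSine F S l' r' := by
  obtain ⟨hF, Z, hZ, hd⟩ := h
  exact ⟨hF.mono (Icc_subset_Icc hl hr), Z, hZ, fun x hx => hd x ⟨by linarith [hx.1],
    by linarith [hx.2]⟩⟩

/-- The quotient is tan (arcsin s), a composition of increasing functions. -/
theorem div_sqrt_one_sub_sq_le {s t : ℝ} (hs : |s| < 1) (ht : |t| < 1) (hst : s ≤ t) :
    s / √(1 - s ^ 2) ≤ t / √(1 - t ^ 2) := by
  have := abs_lt.1 hs
  have := abs_lt.1 ht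
  rw [← Real.tan_arcsin, ← Real.tan_arcsin]
  have h1 : Real.arcsin s ≤ Real.arcsin t := Real.monotone_arcsin hst
  exact Real.strictMonoOn_tan.monotoneOn
    ⟨Real.neg_pi_div_two_lt_arcsin.2 (by linarith), Real.arcsin_lt_pi_div_two.2 (by linarith)⟩
    ⟨Real.neg_pi_div_two_lt_arcsin.2 (by linarith), Real.arcsin_lt_pi_div_two.2 (by linarith)⟩ h1

/-- The steeper curve rises more. -/
theorem HasTangentSine.sub_le_sub {F G S T : ℝ → ℝ} {l r : ℝ} (hlr : l ≤ r)
    (hF : HasTangentSine F S l r) (hG : HasTangentSine G T l r)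
    (h : ∀ x ∈ Ioo l r, S x ≤ T x) : F r - F l ≤ G r - G l := by
  obtain ⟨hFc, Z, hZ, hFd⟩ := hF
  obtain ⟨hGc, W, hW, hGd⟩ := hG
  have := le_of_deriv_nonneg_off_countable (F := fun x => G x - F x) hlr (hGc.sub hFc)
    (hZ.union hW) fun x hx hxZ => by
      have h1 := hFd x hx fun h => hxZ (Or.inl h)
      have h2 := hGd x hx fun h => hxZ (Or.inr h)
      exact ⟨_, sub_nonneg.2 (div_sqrt_one_sub_sq_le h1.1 h2.1 (h x hx)), h2.2.sub h1.2⟩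
  linarith

theorem HasTangentSine.reflect {F S : ℝ → ℝ} {c : ℝ} (h : HasTangentSine F S (-c) c) :
    HasTangentSine (fun x => -F (-x)) (fun x => S (-x)) (-c) c := by
  obtain ⟨hF, Z, hZ, hd⟩ := h
  refine ⟨(hF.comp continuousOn_neg fun x hx => ⟨by linarith [hx.2], by linarith [hx.1]⟩).neg,
    Neg.neg ⁻¹' Z, hZ.preimage neg_injective, fun x hx hxZ => ?_⟩
  obtain ⟨h1, h2⟩ := hd (-x) ⟨by linarith [hx.2], by linarith [hx.1]⟩ hxZ
  refine ⟨h1, ?_⟩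
  have := (h2.comp x (hasDerivAt_neg x)).fun_neg
  simpa [Function.comp_def] using this

/-- A curve with convex tangent sine `S` over the chord `[-c, c]` lies below any curve over this
chord that starts steeper and whose tangent sine `T` is affine up to an abscissa after which it
does not exceed `S`. -/
theorem le_of_convexOn_of_affine {F B S T : ℝ → ℝ} {c j p q : ℝ} (hj : -c ≤ j) (hjc : j ≤ c)
    (hF : HasTangentSine F S (-c) c) (hB : HasTangentSine B T (-c) c)
    (hFl : F (-c) = 0) (hFr : F c = 0) (hBl : B (-c) = 0) (hBr : B c = 0)
    (hS : ConvexOn ℝ (Icc (-c) c) S) (hSc : ContinuousOn S (Icc (-c) c))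
    (hT : ∀ x ∈ Icc (-c) j, T x = p + q * x) (hST : S (-c) ≤ T (-c))
    (hTS : ∀ x ∈ Ioo j c, T x ≤ S x) (x : ℝ) (hx : x ∈ Icc (-c) c) : F x ≤ B x := by
  set h : ℝ → ℝ := fun x => S x - (p + q * x) with hh
  have hsub : Icc (-c) j ⊆ Icc (-c) c := Icc_subset_Icc_right hjc
  have hhc : ContinuousOn h (Icc (-c) j) := (hSc.mono hsub).sub (by fun_prop)
  have hK : IsCompact (Icc (-c) j ∩ h ⁻¹' Iic 0) :=
    isCompact_Icc.of_isClosed_subset (hhc.preimage_isClosed_of_isClosed isClosed_Icc isClosed_Iic)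
      inter_subset_left
  have hl : h (-c) ≤ 0 := by
    have := hT (-c) ⟨le_rfl, hj⟩
    simp only [hh]; linarith
  -- `t` is the last abscissa up to `j` with S ≤ T. Convexity of `h`, nonpositive at `-c` and `t`,
  -- gives S ≤ T on all of [-c, t].
  obtain ⟨t, ⟨ht, ht0⟩, hmax⟩ := hK.exists_isGreatest ⟨-c, ⟨le_rfl, hj⟩, hl⟩
  have ht0' : h t ≤ 0 := ht0
  have hconv : ConvexOn ℝ (Icc (-c) j) h := by
    refine (hS.subset hsub (convex_Icc _ _)).sub ⟨convex_Icc _ _, fun u _ v _ a b _ _ hab => ?_⟩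
    simp only [smul_eq_mul]
    apply le_of_eq
    linear_combination p * hab
  have hle : ∀ x ∈ Ioo (-c) t, S x ≤ T x := by
    intro x hx
    have h1 := hconv.le_max_of_mem_Icc ⟨le_rfl, hj⟩ ht ⟨hx.1.le, hx.2.le⟩
    have h2 := h1.trans (max_le hl ht0')
    rw [hT x ⟨hx.1.le, hx.2.le.trans ht.2⟩]
    simp only [hh] at h2; linarith
  rcases le_total x t with hxt | hxt
  · have := (hF.mono le_rfl hx.2).sub_le_sub hx.1 (hB.mono le_rfl hx.2)
      fun y hy => hle y ⟨hy.1, hy.2.trans_le hxt⟩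
    linarith
  · -- right of `t` it is `T` that does not exceed `S`, except possibly at `j`
    obtain ⟨hFc, Z, hZ, hFd⟩ := hF
    obtain ⟨hBc, W, hW, hBd⟩ := hB
    have := le_of_deriv_nonneg_off_countable (F := fun x => F x - B x) hx.2
      ((hFc.sub hBc).mono (Icc_subset_Icc_left hx.1)) ((hZ.union hW).union (countable_singleton j))
      fun y hy hyZ => by
        have hy' : y ∈ Ioo (-c) c := ⟨hx.1.trans_lt hy.1, hy.2⟩
        have h1 := hFd y hy' fun h => hyZ (Or.inl (Or.inl h))
        have h2 := hBd y hy' fun h => hyZ (Or.inl (Or.inr h))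
        have h3 : T y ≤ S y := by
          rcases lt_trichotomy y j with hyj | hyj | hyj
          · have hyI : y ∈ Icc (-c) j := ⟨hy'.1.le, hyj.le⟩
            by_contra! hlt
            rw [hT y hyI] at hlt
            have h4 := hmax (show y ∈ Icc (-c) j ∩ h ⁻¹' Iic 0 from
              ⟨hyI, show S y - (p + q * y) ≤ 0 by linarith⟩)
            linarith [hy.1]
          · exact absurd (Or.inr hyj) hyZ
          · exact hTS y ⟨hyj, hy.2⟩
        exact ⟨_, sub_nonneg.2 (div_sqrt_one_sub_sq_le h2.1 h1.1 h3), h1.2.sub h2.2⟩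
    linarith

/-! ### Tangent sines of circular arcs -/

theorem tangentArc_eq_of_ne_zero {x₀ φ k x : ℝ} (hφ : 0 ≤ Real.cos φ) (hk : k ≠ 0)
    (hx : |Real.sin φ + k * (x - x₀)| ≤ 1) :
    tangentArc x₀ φ k x = (Real.cos φ - √(1 - (Real.sin φ + k * (x - x₀)) ^ 2)) / k := by
  have h1 : (Real.sin φ + k * (x - x₀)) ^ 2 ≤ 1 := (sq_le_one_iff_abs_le_one _).2 hx
  have h2 := Real.sq_sqrt (sub_nonneg.2 h1)
  have h3 := Real.sin_sq_add_cos_sq φ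
  have h4 := Real.sqrt_nonneg (1 - (Real.sin φ + k * (x - x₀)) ^ 2)
  unfold tangentArc
  generalize √(1 - (Real.sin φ + k * (x - x₀)) ^ 2) = R at *
  -- A zero denominator means vertical tangents at both points; the left side is then 0 by the
  -- convention for division, the right side because its numerator vanishes.
  by_cases h0 : Real.cos φ + R = 0
  · have h5 : Real.cos φ = 0 := by linarith
    have h6 : R = 0 := by linarith
    simp [h5, h6]
  · rw [div_eq_div_iff h0 hk]
    linear_combination h2 - h3

/-- The condition `hk` excludes a vertical segment, which is not a graph. -/
theorem hasTangentSine_tangentArc {x₀ φ k l r : ℝ} (hφ : 0 ≤ Real.cos φ)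
    (hk : Real.cos φ = 0 → k ≠ 0)
    (h : ∀ x ∈ Icc l r, |Real.sin φ + k * (x - x₀)| ≤ 1) :
    HasTangentSine (tangentArc x₀ φ k) (fun x => Real.sin φ + k * (x - x₀)) l r := by
  by_cases hk0 : k = 0
  · have hφ' : 0 < Real.cos φ := lt_of_le_of_ne hφ fun h => hk h.symm hk0
    have h1 : √(1 - Real.sin φ ^ 2) = Real.cos φ := by
      rw [← Real.cos_sq', Real.sqrt_sq hφ]
    have h2 : tangentArc x₀ φ k = fun x => (x - x₀) * (Real.sin φ / Real.cos φ) := by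
      ext x
      simp only [tangentArc, hk0, zero_mul, add_zero, h1]
      field_simp
      ring
    rw [h2]
    refine ⟨by fun_prop, ∅, countable_empty, fun x _ _ => ⟨?_, ?_⟩⟩
    · simp only [hk0, zero_mul, add_zero]
      rw [← sq_lt_one_iff_abs_lt_one]
      have := Real.sin_sq_add_cos_sq φ
      have : 0 < Real.cos φ ^ 2 := by positivity
      linarith
    · simp only [hk0, zero_mul, add_zero, h1]
      simpa using ((hasDerivAt_id x).sub_const x₀).mul_const (Real.sin φ / Real.cos φ)
  · have heq : EqOn (tangentArc x₀ φ k)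
        (fun x => (Real.cos φ - √(1 - (Real.sin φ + k * (x - x₀)) ^ 2)) / k) (Icc l r) :=
      fun x hx => tangentArc_eq_of_ne_zero hφ hk0 (h x hx)
    -- The tangent is vertical only where the sine is ±1, which an affine function of nonzero slope
    -- attains at most twice; these abscissae are the exceptions.
    have hinj : Function.Injective fun x => Real.sin φ + k * (x - x₀) := by
      intro x y hxy
      simpa [hk0] using hxy
    refine ⟨ContinuousOn.congr (by fun_prop) heq, _,
      ((countable_singleton (-1 : ℝ)).insert 1).preimage hinj, fun x hx hxZ => ?_⟩
    have hlt : |Real.sin φ + k * (x - x₀)| < 1 := by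
      refine lt_of_le_of_ne (h x ⟨hx.1.le, hx.2.le⟩) fun h1 => hxZ ?_
      exact (abs_eq zero_le_one).1 h1
    refine ⟨hlt, ?_⟩
    have hpos : 0 < 1 - (Real.sin φ + k * (x - x₀)) ^ 2 :=
      sub_pos.2 ((sq_lt_one_iff_abs_lt_one _).2 hlt)
    have hS : HasDerivAt (fun x => Real.sin φ + k * (x - x₀)) k x := by
      simpa using (((hasDerivAt_id x).sub_const x₀).const_mul k).const_add (Real.sin φ)
    have hd := ((((hS.fun_pow 2).const_sub 1).sqrt hpos.ne').const_sub (Real.cos φ)).div_const k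
    refine (hd.congr_deriv ?_).congr_of_eventuallyEq
      (heq.eventuallyEq_of_mem (Icc_mem_nhds hx.1 hx.2))
    have hne := (Real.sqrt_pos.2 hpos).ne'
    norm_num only
    generalize √(1 - (Real.sin φ + k * (x - x₀)) ^ 2) = R at *
    field_simp

theorem tangentArc_neg (x₀ φ k x : ℝ) :
    tangentArc (-x₀) φ (-k) (-x) = -tangentArc x₀ φ k x := by
  simp only [tangentArc]
  have h1 : -k * (-x - -x₀) = k * (x - x₀) := by ring
  rw [h1, ← neg_div]
  congr 1
  ring

theorem tangentArc_self (x₀ φ k : ℝ) : tangentArc x₀ φ k x₀ = 0 := by simp [tangentArc]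

/-- By symmetry the sine goes from sin φ to -sin φ over the length 2c, whence the curvature -sin φ /
c. -/
theorem chordArc_eq_tangentArc {c : ℝ} (hc : 0 < c) (φ x : ℝ) :
    chordArc c φ x = tangentArc (-c) φ (-Real.sin φ / c) x := by
  have h1 : Real.sin φ + -Real.sin φ / c * (x - -c) = -(x * Real.sin φ) / c := by
    field_simp; ring
  have h2 : √(c ^ 2 - x ^ 2 * Real.sin φ ^ 2) = c * √(1 - (-(x * Real.sin φ) / c) ^ 2) := by
    rw [← Real.sqrt_sq hc.le, ← Real.sqrt_mul (by positivity), Real.sqrt_sq hc.le]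
    congr 1
    field_simp
  simp only [chordArc, tangentArc]
  rw [h1, h2, ← mul_add, two_mul, add_assoc, h1, ← mul_div_mul_left _ (_ + _) hc.ne']
  congr 1
  field_simp
  ring

theorem chordArc_neg_angle (c φ x : ℝ) : chordArc c (-φ) x = -chordArc c φ x := by
  simp [chordArc, neg_div]

theorem chordArc_neg_apply (c φ x : ℝ) : chordArc c φ (-x) = chordArc c φ x := by
  simp [chordArc]

theorem chordArc_right (c φ : ℝ) : chordArc c φ c = 0 := by simp [chordArc]

theorem chordArc_left (c φ : ℝ) : chordArc c φ (-c) = 0 := by simp [chordArc]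

theorem hasTangentSine_chordArc {c φ : ℝ} (hc : 0 < c) (hφ : 0 ≤ Real.cos φ) :
    HasTangentSine (chordArc c φ) (fun x => Real.sin φ + -Real.sin φ / c * (x - -c)) (-c) c := by
  rw [funext (chordArc_eq_tangentArc hc φ)]
  refine hasTangentSine_tangentArc hφ (fun h => ?_) fun x hx => ?_
  · have := Real.sin_sq_add_cos_sq φ
    rw [h] at this
    refine div_ne_zero (neg_ne_zero.2 fun h0 => ?_) hc.ne'
    norm_num [h0] at this
  · have h1 : Real.sin φ + -Real.sin φ / c * (x - -c) = -(x / c * Real.sin φ) := by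
      field_simp; ring
    rw [h1, abs_neg, abs_mul, abs_div, abs_of_pos hc]
    exact mul_le_one₀ ((div_le_one hc).2 (abs_le.2 hx)) (abs_nonneg _) (Real.abs_sin_le_one φ)

/-! ### Tangent sines of biarcs -/

theorem abs_biarc_joint_sine_le {c α β p : ℝ} (hc : 0 < c) (hα : α ≤ Real.pi / 2)
    (hβ : β ≤ Real.pi / 2) (h : 0 < α + β) (hp : 0 < p) :
    |Real.sin α + biarcStartCurvature c α β p * (biarcJoint c α β p - -c)| ≤ 1 := by
  obtain ⟨w, g, rfl, rfl⟩ : ∃ w g : ℝ, α = w + g ∧ β = w - g :=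
    ⟨(α + β) / 2, (α - β) / 2, by ring, by ring⟩
  have e1 : (w + g + (w - g)) / 2 = w := by ring
  have e2 : (w + g - (w - g)) / 2 = g := by ring
  have hcg : 0 ≤ Real.cos g :=
    Real.cos_nonneg_of_neg_pi_div_two_le_of_le (by linarith) (by linarith)
  have hw := Real.sin_sq_add_cos_sq w
  have hg := Real.sin_sq_add_cos_sq g
  simp only [biarcJoint, biarcStartCurvature, e1, e2]
  rw [Real.sin_add]
  generalize Real.sin w = sw at *
  generalize Real.cos w = cw at *
  generalize Real.sin g = sg at *
  generalize Real.cos g = cg at *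
  obtain ⟨D, hD⟩ : ∃ D, D = p ^ 2 + 2 * p * cg + 1 := ⟨_, rfl⟩
  have hDpos : 0 < D := by rw [hD]; positivity
  have hS : sw * cg + cw * sg + -(sw * cg + cw * sg + sw / p) / c *
      (c * (p ^ 2 - 1) / D - -c) =
      -(p ^ 2 * (sw * cg + cw * sg) + (sw * cg - cw * sg) + 2 * p * sw) / D := by
    field_simp; rw [hD]; ring
  rw [← hD, hS, ← sq_le_one_iff_abs_le_one, div_pow, div_le_one (by positivity)]
  -- This is 1 - sin² = cos² for the tangent at the joint, with the denominator D² cleared.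
  have : D ^ 2 - (-(p ^ 2 * (sw * cg + cw * sg) + (sw * cg - cw * sg) + 2 * p * sw)) ^ 2 =
      (p ^ 2 * (cw * cg - sw * sg) + (cw * cg + sw * sg) + 2 * p * cw) ^ 2 := by
    rw [hD]
    linear_combination -(p ^ 4 * (sg ^ 2 + cg ^ 2) + (sg ^ 2 + cg ^ 2) + 4 * p ^ 2 +
      2 * p ^ 2 * (cg ^ 2 - sg ^ 2) + 4 * p ^ 3 * cg + 4 * p * cg) * hw +
      (2 * p ^ 2 - p ^ 4 - 1) * hg
  nlinarith [sq_nonneg (p ^ 2 * (cw * cg - sw * sg) + (cw * cg + sw * sg) + 2 * p * cw)]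

theorem abs_affine_le_one {u k x₀ l r x : ℝ} (hl : |u + k * (l - x₀)| ≤ 1)
    (hr : |u + k * (r - x₀)| ≤ 1) (hx : x ∈ Icc l r) : |u + k * (x - x₀)| ≤ 1 := by
  rw [abs_le] at *
  rcases le_total 0 k with hk | hk
  · have h1 := mul_le_mul_of_nonneg_left hx.1 hk
    have h2 := mul_le_mul_of_nonneg_left hx.2 hk
    constructor <;> linarith
  · have h1 := mul_le_mul_of_nonpos_left hx.1 hk
    have h2 := mul_le_mul_of_nonpos_left hx.2 hk
    constructor <;> linarith

theorem biarc₀_ofReal {c α β p x : ℝ} (h : 0 < α + β) (hp : 0 < p) :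
    biarc₀ c α β (ENNReal.ofReal p) x = if x ≤ biarcJoint c α β p then
      tangentArc (-c) α (biarcStartCurvature c α β p) x
      else tangentArc c β (biarcEndCurvature c α β p) x := by
  simp [biarc₀, h.ne', hp, hp.le, ENNReal.toReal_ofReal]

theorem HasTangentSine.piecewise {F G S T : ℝ → ℝ} {l j r : ℝ} (hlj : l ≤ j) (hjr : j ≤ r)
    (hF : HasTangentSine F S l j) (hG : HasTangentSine G T j r) (h : F j = G j) :
    HasTangentSine (fun x => if x ≤ j then F x else G x) (fun x => if x ≤ j then S x else T x)
      l r := by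
  obtain ⟨hFc, Z, hZ, hFd⟩ := hF
  obtain ⟨hGc, W, hW, hGd⟩ := hG
  constructor
  · rw [← Icc_union_Icc_eq_Icc hlj hjr]
    refine ContinuousOn.union_of_isClosed ?_ ?_ isClosed_Icc isClosed_Icc
    · exact hFc.congr fun x hx => if_pos hx.2
    · refine hGc.congr fun x hx => ?_
      rcases hx.1.eq_or_lt with rfl | hlt
      · simp [h]
      · simp [not_le.2 hlt]
  · refine ⟨(Z ∪ W) ∪ {j}, (hZ.union hW).union (countable_singleton j), fun x hx hxZ => ?_⟩
    simp only [mem_union, mem_singleton_iff, not_or] at hxZ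
    rcases lt_or_gt_of_ne hxZ.2 with hlt | hlt
    · obtain ⟨h1, h2⟩ := hFd x ⟨hx.1, hlt⟩ hxZ.1.1
      simp only [hlt.le, if_true]
      refine ⟨h1, h2.congr_of_eventuallyEq ?_⟩
      filter_upwards [Iio_mem_nhds hlt] with y hy using if_pos (le_of_lt hy)
    · obtain ⟨h1, h2⟩ := hGd x ⟨hlt, hx.2⟩ hxZ.1.2
      simp only [not_le.2 hlt, if_false]
      refine ⟨h1, h2.congr_of_eventuallyEq ?_⟩
      filter_upwards [Ioi_mem_nhds hlt] with y hy using if_neg (not_le.2 hy)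

theorem hasTangentSine_biarc₀ {c α β p : ℝ} (hc : 0 < c) (hα : α ≤ Real.pi / 2)
    (hβ : β ≤ Real.pi / 2) (h : 0 < α + β) (hp : 0 < p) :
    HasTangentSine (biarc₀ c α β (ENNReal.ofReal p)) (fun x => if x ≤ biarcJoint c α β p then
      Real.sin α + biarcStartCurvature c α β p * (x - -c)
      else Real.sin β + biarcEndCurvature c α β p * (x - c)) (-c) c := by
  obtain ⟨hj, hs, ho⟩ := biarc_join c α β p hc hα hβ h hp
  have hjs := abs_biarc_joint_sine_le hc hα hβ h hp
  have hω : 0 < Real.sin ((α + β) / 2) :=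
    Real.sin_pos_of_pos_of_lt_pi (by linarith) (by linarith [Real.pi_pos])
  -- Both end inclinations exceed -π/2, so a vertical end tangent has sine 1, and the curvature of
  -- its arc is nonzero.
  have hright : ∀ φ : ℝ, -(Real.pi / 2) < φ → φ ≤ Real.pi / 2 → Real.cos φ = 0 →
      Real.sin φ = 1 := by
    intro φ h1 h2 h3
    rcases h2.eq_or_lt with rfl | h4
    · exact Real.sin_pi_div_two
    · exact absurd h3 (Real.cos_pos_of_mem_Ioo ⟨h1, h4⟩).ne'
  rw [show biarc₀ c α β (ENNReal.ofReal p) = _ from funext fun x => biarc₀_ofReal h hp]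
  refine HasTangentSine.piecewise hj.1.le hj.2.le ?_ ?_ ho
  · refine hasTangentSine_tangentArc
      (Real.cos_nonneg_of_neg_pi_div_two_le_of_le (by linarith) hα) (fun h0 => ?_)
      fun x hx => abs_affine_le_one (by simpa using Real.abs_sin_le_one α) hjs hx
    rw [biarcStartCurvature, hright α (by linarith) hα h0]
    have : 0 < (1 + Real.sin ((α + β) / 2) / p) / c := by positivity
    rw [neg_div]
    exact (neg_lt_zero.2 this).ne
  · refine hasTangentSine_tangentArc
      (Real.cos_nonneg_of_neg_pi_div_two_le_of_le (by linarith) hβ) (fun h0 => ?_)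
      fun x hx => abs_affine_le_one (hs ▸ hjs) (by simpa using Real.abs_sin_le_one β) hx
    rw [biarcEndCurvature, hright β (by linarith) hβ h0]
    positivity

/-! ### Reflection in the origin -/

/-- Reflection of a biarc in the origin. -/
theorem biarc₀_reflect {c α β : ℝ} (hc : 0 < c) (hα : α ≤ Real.pi / 2) (hβ : β ≤ Real.pi / 2)
    (h : 0 ≤ α + β) (p : ENNReal) (x : ℝ) :
    biarc₀ c α β p x = -biarc₀ c β α p⁻¹ (-x) := by
  rcases h.eq_or_lt with h0 | h0
  · have h1 : β = -α := by linarith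
    simp [biarc₀, h1, chordArc_neg_angle, chordArc_neg_apply]
  · have h0' : 0 < β + α := by linarith
    by_cases hp0 : p = 0
    · simp [biarc₀, h0.ne', h0'.ne', hp0, chordArc_neg_angle, chordArc_neg_apply]
    by_cases hpt : p = ⊤
    · simp [biarc₀, h0.ne', h0'.ne', hpt, chordArc_neg_angle, chordArc_neg_apply]
    obtain ⟨q, hq, rfl⟩ : ∃ q : ℝ, 0 < q ∧ p = ENNReal.ofReal q :=
      ⟨p.toReal, ENNReal.toReal_pos hp0 hpt, (ENNReal.ofReal_toReal hpt).symm⟩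
    rw [← ENNReal.ofReal_inv_of_pos hq, biarc₀_ofReal h0 hq, biarc₀_ofReal h0' (inv_pos.2 hq)]
    have hD : 0 < q ^ 2 + 2 * q * Real.cos ((α - β) / 2) + 1 := by
      have : 0 ≤ Real.cos ((α - β) / 2) :=
        Real.cos_nonneg_of_neg_pi_div_two_le_of_le (by linarith) (by linarith)
      positivity
    have e1 : biarcJoint c β α q⁻¹ = -biarcJoint c α β q := by
      have : (β - α) / 2 = -((α - β) / 2) := by ring
      unfold biarcJoint
      rw [this, Real.cos_neg]
      have h2 : (q⁻¹) ^ 2 + 2 * q⁻¹ * Real.cos ((α - β) / 2) + 1 =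
        (q ^ 2 + 2 * q * Real.cos ((α - β) / 2) + 1) / q ^ 2 := by field_simp; ring
      rw [h2]
      field_simp
      ring
    have e2 : biarcStartCurvature c β α q⁻¹ = -biarcEndCurvature c α β q := by
      simp only [biarcStartCurvature, biarcEndCurvature, add_comm β α]
      field_simp
    have e3 : biarcEndCurvature c β α q⁻¹ = -biarcStartCurvature c α β q := by
      simp only [biarcStartCurvature, biarcEndCurvature, add_comm β α]
      field_simp
    have e4 := tangentArc_neg (-c) α (biarcStartCurvature c α β q) x
    rw [neg_neg] at e4
    simp only [e1, e2, e3, neg_le_neg_iff, tangentArc_neg, e4]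
    rcases lt_trichotomy x (biarcJoint c α β q) with hx | hx | hx
    · simp [hx.le, not_le.2 hx]
    -- At the joint each side evaluates its own first arc; after reflection these are the two
    -- different arcs of the biarc, which meet there.
    · simp only [hx, le_refl, if_true, neg_neg]
      exact (biarc_join c α β q hc hα hβ h0 hq).2.2
    · simp [hx.le, not_le.2 hx]

/-- Reflection turns p into 1/p, hence `a` into `-a`. The alternative `b = ⊤` is needed where p is
truncated to 0, namely for infinite `a` or `a * c + sin α > 0`: its inverse is ∞. -/
theorem biarc₁_eq_neg_biarc₂ {c α β : ℝ} (hc : 0 < c) (hα : α ≤ Real.pi / 2)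
    (hβ : β ≤ Real.pi / 2) (h : 0 ≤ α + β) (a : EReal) (x : ℝ) :
    ∃ b : EReal, (b = ⊤ ∨ b = -a) ∧ biarc₁ c α β a x = -biarc₂ c β α b (-x) := by
  unfold biarc₁ biarc₂
  rw [biarc₀_reflect hc hα hβ h]
  rcases h.eq_or_lt with h0 | h0
  · have h1 : β + α = 0 := by linarith
    exact ⟨⊤, Or.inl rfl, by simp [biarc₀, h1]⟩
  have hω : 0 < Real.sin ((β + α) / 2) :=
    Real.sin_pos_of_pos_of_lt_pi (by linarith) (by linarith [Real.pi_pos])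
  induction a with
  | bot => exact ⟨⊤, Or.inl rfl, by simp⟩
  | top => exact ⟨⊤, Or.inl rfl, by simp⟩
  | coe a =>
    rcases lt_trichotomy (a * c + Real.sin α) 0 with ha | ha | ha
    · refine ⟨-a, Or.inr rfl, ?_⟩
      have h2 : 0 < -Real.sin ((α + β) / 2) / (a * c + Real.sin α) := by
        rw [add_comm α β]
        exact div_pos_of_neg_of_neg (by linarith) ha
      have h3 : (-(a : EReal)) = ((-a : ℝ) : EReal) := rfl
      simp only [h3, EReal.coe_ne_bot, EReal.coe_ne_top, or_self, if_false, EReal.toReal_coe,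
        ha.ne, ← ENNReal.ofReal_inv_of_pos h2]
      congr 3
      rw [inv_div, add_comm α β, div_neg, ← neg_div]
      congr 1
      ring
    · refine ⟨-a, Or.inr rfl, ?_⟩
      have h3 : (-(a : EReal)) = ((-a : ℝ) : EReal) := rfl
      have h4 : -(a * c) - Real.sin α = 0 := by linarith
      simp [h3, ha, h4, -EReal.coe_neg]
    · refine ⟨⊤, Or.inl rfl, ?_⟩
      have h2 : -Real.sin ((α + β) / 2) / (a * c + Real.sin α) ≤ 0 := by
        rw [add_comm α β]
        exact div_nonpos_of_nonpos_of_nonneg (by linarith) ha.le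
      simp [ha.ne', ENNReal.ofReal_of_nonpos h2]

/-! ### The upper bound -/

/-- A curve over the chord `[-c, c]` with convex tangent sine `S` lies below the biarc with
end curvature `b`, if the latter starts steeper, ends less steep, and `b` bounds the slopes of
the chords of `S` that end at `c`. -/
theorem HasTangentSine.le_biarc₂ {c α β : ℝ} {b : EReal} {F S : ℝ → ℝ} (hc : 0 < c)
    (hα : α ≤ Real.pi / 2) (hβ : β ≤ Real.pi / 2) (h : 0 ≤ α + β)
    (hF : HasTangentSine F S (-c) c) (hFl : F (-c) = 0) (hFr : F c = 0)
    (hS : ConvexOn ℝ (Icc (-c) c) S) (hSc : ContinuousOn S (Icc (-c) c))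
    (hSl : S (-c) ≤ Real.sin α) (hSr : Real.sin β ≤ S c)
    (hb : ∀ k : ℝ, b = k → ∀ x ∈ Icc (-c) c, S c + k * (x - c) ≤ S x)
    (x : ℝ) (hx : x ∈ Icc (-c) c) : F x ≤ biarc₂ c α β b x := by
  have hcosα : 0 ≤ Real.cos α := Real.cos_nonneg_of_neg_pi_div_two_le_of_le (by linarith) hα
  have hcosβ : 0 ≤ Real.cos β := Real.cos_nonneg_of_neg_pi_div_two_le_of_le (by linarith) hβ
  -- A single arc is the comparison with `j = c`, so nothing is required after the joint. This
  -- settles p = ∞ and α + β = 0.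
  have hchord : F x ≤ chordArc c α x :=
    le_of_convexOn_of_affine (j := c) (p := 0) (q := -Real.sin α / c) (by linarith) le_rfl hF
      (hasTangentSine_chordArc hc hcosα) hFl hFr (chordArc_left c α) (chordArc_right c α) hS hSc
      (fun x _ => by field_simp; ring) (by simpa using hSl)
      (fun x hx => absurd (hx.1.trans hx.2) (lt_irrefl _)) x hx
  unfold biarc₂
  rcases h.eq_or_lt with h0 | h0
  · simpa [biarc₀, ← h0] using hchord
  by_cases hb' : b = ⊥ ∨ b = ⊤
  · simpa [biarc₀, h0.ne', hb'] using hchord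
  rw [if_neg hb']
  lift b to ℝ using ⟨fun h => hb' (Or.inr h), fun h => hb' (Or.inl h)⟩
  rw [EReal.toReal_coe]
  have hω : 0 < Real.sin ((α + β) / 2) :=
    Real.sin_pos_of_pos_of_lt_pi (by linarith) (by linarith [Real.pi_pos])
  have hbS : ∀ x ∈ Icc (-c) c, Real.sin β + b * (x - c) ≤ S x :=
    fun x hx => by linarith [hb b rfl x hx]
  -- For p ≤ 0 the biarc is the arc ending with inclination β. Its curvature is sin β / c ≥ b, so
  -- its sine stays below `S` throughout, and comparing rises from `x` to `c` suffices.
  rcases le_or_gt ((b * c - Real.sin β) / Real.sin ((α + β) / 2)) 0 with hp | hp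
  · rw [ENNReal.ofReal_of_nonpos hp]
    have hbc : b ≤ Real.sin β / c := by
      rw [le_div_iff₀ hc]
      rw [div_le_iff₀ hω, zero_mul] at hp
      linarith
    have hA := hasTangentSine_chordArc (φ := -β) hc (by simpa using hcosβ)
    have hle : ∀ y ∈ Ioo x c, Real.sin (-β) + -Real.sin (-β) / c * (y - -c) ≤ S y := by
      intro y hy
      have h1 := hbS y ⟨hx.1.trans hy.1.le, hy.2.le⟩
      have h2 := mul_le_mul_of_nonpos_right hbc (sub_nonpos.2 hy.2.le)
      have h3 : Real.sin (-β) + -Real.sin (-β) / c * (y - -c) =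
          Real.sin β + Real.sin β / c * (y - c) := by
        rw [Real.sin_neg]; field_simp; ring
      linarith
    have h1 := (hA.mono hx.1 le_rfl).sub_le_sub hx.2 (hF.mono hx.1 le_rfl) hle
    rw [hFr, chordArc_right] at h1
    have h2 : F x ≤ chordArc c (-β) x := by linarith
    simpa [biarc₀, h0.ne'] using h2
  · set p := (b * c - Real.sin β) / Real.sin ((α + β) / 2) with hpdef
    have hend : biarcEndCurvature c α β p = b := by
      rw [biarcEndCurvature, hpdef]
      field_simp
      ring
    obtain ⟨hj, -, -⟩ := biarc_join c α β p hc hα hβ h0 hp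
    refine le_of_convexOn_of_affine (j := biarcJoint c α β p)
      (p := Real.sin α + biarcStartCurvature c α β p * c) (q := biarcStartCurvature c α β p)
      hj.1.le hj.2.le hF (hasTangentSine_biarc₀ hc hα hβ h0 hp) hFl hFr ?_ ?_ hS hSc
      (fun y hy => ?_) ?_ (fun y hy => ?_) x hx
    · rw [biarc₀_ofReal h0 hp, if_pos hj.1.le, tangentArc_self]
    · rw [biarc₀_ofReal h0 hp, if_neg (not_le.2 hj.2), tangentArc_self]
    · rw [if_pos hy.2]; ring
    · rw [if_pos hj.1.le]; simpa using hSl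
    · rw [if_neg (not_le.2 hy.1), hend]
      exact hbS y ⟨hj.1.le.trans hy.1.le, hy.2.le⟩

/-! ### Tangents and curvature of the spiral arc -/

/-- This keeps the end inclinations in the range where the sine is increasing. -/
theorem HasTangentAngle.neg_pi_div_two_le {f : ℝ → ℝ} {l r x θ : ℝ} (hlr : l < r)
    (hx : x ∈ Icc l r) (hx' : x ∉ Ioo l r) (h : HasTangentAngle f (Icc l r) x θ) :
    -(Real.pi / 2) ≤ θ := by
  have : (𝓝[Icc l r \ {x}] x).NeBot := by
    rw [← mem_closure_iff_nhdsWithin_neBot]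
    have hsub : Ioo l r ⊆ Icc l r \ {x} := by
      refine fun y hy => ⟨Ioo_subset_Icc_self hy, ?_⟩
      rintro rfl
      exact hx' hy
    apply closure_mono hsub
    rwa [closure_Ioo hlr.ne]
  exact ge_of_tendsto h (Eventually.of_forall fun y => (Real.neg_pi_div_two_lt_arctan _).le)

theorem HasTangentAngle.eq_arctan_deriv {f : ℝ → ℝ} {l r x θ : ℝ} (hx : x ∈ Ioo l r)
    (h : HasTangentAngle f (Icc l r) x θ) (hf : DifferentiableAt ℝ f x) :
    θ = Real.arctan (deriv f x) := by
  have h1 : 𝓝[Icc l r \ {x}] x = 𝓝[≠] x := by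
    rw [sdiff_eq, nhdsWithin_inter_of_mem (mem_nhdsWithin_of_mem_nhds (Icc_mem_nhds hx.1 hx.2))]
  unfold HasTangentAngle at h
  rw [h1] at h
  refine tendsto_nhds_unique h ((Real.continuous_arctan.tendsto _).comp ?_)
  refine (hasDerivAt_iff_tendsto_slope.1 hf.hasDerivAt).congr fun y => ?_
  rw [slope_def_field]

theorem div_sqrt_one_sub_sq_sin_arctan (v : ℝ) :
    Real.sin (Real.arctan v) / √(1 - Real.sin (Real.arctan v) ^ 2) = v := by
  rw [← Real.cos_sq', Real.sqrt_sq (Real.cos_arctan_pos v).le, ← Real.tan_eq_sin_div_cos,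
    Real.tan_arctan]

theorem abs_sin_arctan_lt_one (v : ℝ) : |Real.sin (Real.arctan v)| < 1 := by
  rw [← sq_lt_one_iff_abs_lt_one]
  have h1 := Real.sin_sq_add_cos_sq (Real.arctan v)
  have h2 := pow_pos (Real.cos_arctan_pos v) 2
  linarith

/-- The curvature is the derivative, with respect to the abscissa, of the sine of the inclination
of the tangent. -/
theorem HasCurvatureAt.hasDerivAt_sin {f τ : ℝ → ℝ} {l r x k : ℝ} (hx : x ∈ Ioo l r)
    (hτ : ∀ x ∈ Icc l r, HasTangentAngle f (Icc l r) x (τ x)) (h : HasCurvatureAt f x k) :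
    HasDerivAt (fun x => Real.sin (τ x)) k x := by
  obtain ⟨h1, h2, rfl⟩ := h
  have hd := h2.hasDerivAt.arctan.sin
  have heq : (fun x => Real.sin (τ x)) =ᶠ[𝓝 x] fun x => Real.sin (Real.arctan (deriv f x)) := by
    filter_upwards [h1, Ioo_mem_nhds hx.1 hx.2] with y hy hyI
    rw [(hτ y ⟨hyI.1.le, hyI.2.le⟩).eq_arctan_deriv hyI hy]
  refine (hd.congr_deriv ?_).congr_of_eventuallyEq heq
  have hpos : 0 < 1 + deriv f x ^ 2 := by positivity
  -- The derivative of sin (arctan v) is (1 + v²)^(-3/2): a factor 1 + v² comes from the arctangent,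
  -- its root from the cosine.
  have h3 : (1 + deriv f x ^ 2) ^ (3 / 2 : ℝ) = (1 + deriv f x ^ 2) * √(1 + deriv f x ^ 2) := by
    rw [show (3 / 2 : ℝ) = 1 + 1 / 2 by norm_num, Real.rpow_add hpos, Real.rpow_one,
      Real.sqrt_eq_rpow]
  rw [h3, Real.cos_arctan]
  field_simp

/-! ### The enclosure by two biarcs -/

theorem proposition4 (c α β α' α'' β' β'' : ℝ) (a b : EReal) (f : ℝ → ℝ)
    (hf : IsSpiralArc c α β f)
    (hα' : α' ≤ α) (hα'' : α ≤ α'') (hβ' : β' ≤ β) (hβ'' : β ≤ β'')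
    (hα''_le : α'' ≤ Real.pi / 2) (hβ''_le : β'' ≤ Real.pi / 2)
    (hκ : ∀ x ∈ Set.Ioo (-c) c, ∀ k : ℝ, HasCurvatureAt f x k → a ≤ (k : EReal) ∧ (k : EReal) ≤ b) :
    (0 ≤ α' + β'' → ∀ x ∈ Set.Icc (-c) c, biarc₁ c α' β'' a x ≤ f x) ∧
    (0 ≤ α'' + β' → ∀ x ∈ Set.Icc (-c) c, f x ≤ biarc₂ c α'' β' b x) := by
  have hc := hf.chord_pos
  obtain ⟨τ, hτc, rfl, rfl, hτ⟩ := hf.tangent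
  set S : ℝ → ℝ := fun x => Real.sin (τ x) with hSdef
  set Z := {x ∈ Ioo (-c) c | ¬ ∃ k, HasCurvatureAt f x k}
  have hZ : Z.Countable := hf.curvature_countable
  have hcurv : ∀ x ∈ Ioo (-c) c, x ∉ Z → ∃ k, HasCurvatureAt f x k ∧ HasDerivAt S k x := by
    intro x hx hxZ
    obtain ⟨k, hk⟩ : ∃ k, HasCurvatureAt f x k := by
      by_contra h
      exact hxZ ⟨hx, h⟩
    exact ⟨k, hk, hk.hasDerivAt_sin hx hτ⟩
  have hSc : ContinuousOn S (Icc (-c) c) := Real.continuous_sin.comp_continuousOn hτc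
  have hS : ConvexOn ℝ (Icc (-c) c) S := by
    refine convexOn_of_deriv_mono_off_countable hSc hZ (fun x hx hxZ => ?_)
      fun x hx y hy hxy hxZ hyZ => ?_
    · obtain ⟨k, -, hk⟩ := hcurv x hx hxZ
      exact hk.differentiableAt
    · obtain ⟨k, hk, hk'⟩ := hcurv x hx hxZ
      obtain ⟨m, hm, hm'⟩ := hcurv y hy hyZ
      rw [hk'.deriv, hm'.deriv]
      exact hf.curvature_mono x hx y hy hxy k m hk hm
  have hF : HasTangentSine f S (-c) c := by
    refine ⟨hf.continuousOn, Z, hZ, fun x hx hxZ => ?_⟩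
    obtain ⟨k, hk, -⟩ := hcurv x hx hxZ
    have hd : DifferentiableAt ℝ f x := hk.1.self_of_nhds
    have h1 : S x = Real.sin (Real.arctan (deriv f x)) := by
      rw [hSdef]
      simp only [(hτ x ⟨hx.1.le, hx.2.le⟩).eq_arctan_deriv hx hd]
    rw [h1, div_sqrt_one_sub_sq_sin_arctan]
    exact ⟨abs_sin_arctan_lt_one _, hd.hasDerivAt⟩
  have hcc : -c < c := by linarith
  have hrange : -(Real.pi / 2) ≤ τ (-c) ∧ -(Real.pi / 2) ≤ τ c :=
    ⟨(hτ _ (left_mem_Icc.2 hcc.le)).neg_pi_div_two_le hcc (left_mem_Icc.2 hcc.le)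
      fun h => lt_irrefl _ h.1,
    (hτ _ (right_mem_Icc.2 hcc.le)).neg_pi_div_two_le hcc (right_mem_Icc.2 hcc.le)
      fun h => lt_irrefl _ h.2⟩
  constructor
  · intro h x hx
    obtain ⟨b', hb', heq⟩ := biarc₁_eq_neg_biarc₂ hc (hα'.trans (hα''.trans hα''_le)) hβ''_le h a x
    have hmaps : ∀ y ∈ Icc (-c) c, -y ∈ Icc (-c) c :=
      fun y hy => ⟨neg_le_neg hy.2, by linarith [hy.1]⟩
    have hconv : ConvexOn ℝ (Icc (-c) c) fun x => S (-x) := by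
      have h1 := hS.comp_linearMap (-LinearMap.id : ℝ →ₗ[ℝ] ℝ)
      refine h1.subset (fun y hy => ?_) (convex_Icc _ _)
      exact hmaps y hy
    -- The upper bound is applied to -f(-x), whose tangent sine S(-x) starts at S(c) and ends at
    -- S(-c).
    have := hF.reflect.le_biarc₂ (α := β'') (β := α') (b := b') hc hβ''_le
      (hα'.trans (hα''.trans hα''_le)) (by linarith)
      (by simp [hf.right_eq]) (by simp [hf.left_eq]) hconv
      (hSc.comp continuousOn_neg hmaps)
      (by
        rw [neg_neg]
        exact Real.sin_le_sin_of_le_of_le_pi_div_two hrange.2 hβ''_le hβ'')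
      (Real.sin_le_sin_of_le_of_le_pi_div_two (by linarith) (hα''.trans hα''_le) hα')
      (fun k hk y hy => by
        have hak : a = ((-k : ℝ) : EReal) := by
          rcases hb' with h1 | h1
          · rw [h1] at hk; exact absurd hk.symm (EReal.coe_ne_top k)
          · rw [EReal.coe_neg, ← hk, h1, neg_neg]
        -- Here a = -k, so κ ≥ a makes S t + k t nondecreasing; an infinite `b'` imposes nothing.
        have := le_of_deriv_nonneg_off_countable (F := fun t => S t + k * t) (hmaps y hy).1
          ((hSc.mono (Icc_subset_Icc_right (hmaps y hy).2)).add (by fun_prop)) hZ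
          fun t ht htZ => by
            have htI : t ∈ Ioo (-c) c := ⟨ht.1, ht.2.trans_le (hmaps y hy).2⟩
            obtain ⟨m, hm, hm'⟩ := hcurv t htI htZ
            have h1 := (hκ t htI m hm).1
            rw [hak, EReal.coe_le_coe_iff] at h1
            exact ⟨_, by linarith, hm'.add ((hasDerivAt_id t).const_mul k)⟩
        linarith)
      (-x) (hmaps x hx)
    simp only [neg_neg] at this
    linarith
  · intro h x hx
    refine hF.le_biarc₂ hc hα''_le (hβ'.trans (hβ''.trans hβ''_le)) h hf.left_eq hf.right_eq hS hSc
      (Real.sin_le_sin_of_le_of_le_pi_div_two hrange.1 hα''_le hα'')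
      (Real.sin_le_sin_of_le_of_le_pi_div_two (by linarith) (hβ''.trans hβ''_le) hβ')
      (fun k hk y hy => ?_) x hx
    have := le_of_deriv_nonneg_off_countable (F := fun t => k * t - S t) hy.2
      (ContinuousOn.sub (by fun_prop) (hSc.mono (Icc_subset_Icc_left hy.1))) hZ
      fun t ht htZ => by
        have htI : t ∈ Ioo (-c) c := ⟨hy.1.trans_lt ht.1, ht.2⟩
        obtain ⟨m, hm, hm'⟩ := hcurv t htI htZ
        have h1 := (hκ t htI m hm).2
        rw [hk, EReal.coe_le_coe_iff] at h1
        exact ⟨_, by linarith, ((hasDerivAt_id t).const_mul k).sub hm'⟩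
    linarith
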